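/- All rings are associative with identity, not necessarily commutative. For a ring $R$, let $J(R)$ denote its Jacobson radical. An element $a\in R$ is called *uniquely strongly clean* if there exists a unique idempotent $e\in R$ such that $a-e$ is invertible in $R$ and $ae=ea$. The ring $R$ is called *GUSC* (generalized uniquely strongly clean) if every non-invertible element of $R$ is uniquely strongly clean. A group is *locally finite* if each of its finitely generated subgroups is finite, and it is a *$2$-group* if the order of each of its elements is a (finite) power of $2$. Let $R$ be a ring such that $R/J(R)\cong\mathbb{Z}_2$ (as rings, where $\mathbb{Z}_2=\mathbb{Z}/2\mathbb{Z}$), and let $G$ be a locally finite group. Then the group ring $RG$ is GUSC if and only if $G$ is a $2$-group. -/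

import Mathlib

/-- An element `a` of a ring is uniquely strongly clean if there is a unique idempotent `e`,
commuting with `a`, such that `a - e` is invertible. -/
def IsUniquelyStronglyClean {R : Type*} [Ring R] (a : R) : Prop :=
  ∃! e : R, IsIdempotentElem e ∧ IsUnit (a - e) ∧ a * e = e * a

/-- A ring is generalized uniquely strongly clean (GUSC) if each of its non-invertible elements
is uniquely strongly clean. -/
def IsGUSC (R : Type*) [Ring R] : Prop :=
  ∀ a : R, ¬ IsUnit a → IsUniquelyStronglyClean a

/-- A group is locally finite if each of its finitely generated subgroups is finite. -/
def IsLocallyFiniteGroup (G : Type*) [Group G] : Prop :=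
  ∀ H : Subgroup G, H.FG → Finite H

/-! Let `ε : RG → ZMod 2` be the augmentation followed by reduction modulo `J(R)`. If `G` is a
2-group, every `x` with `ε x = 1` is a unit: `x` lies in `RH` for a finite 2-group `H`, Nakayama
reduces to coefficients in `ZMod 2`, and a fixed point count settles that case. So a non-unit has `ε
= 0`, and its idempotent must satisfy `ε e = 1`; it is then a unit, hence `1`. Conversely, let `g`
have odd order `m`, which is invertible in `R`. The non-unit `1 - g` admits both `1` and the average
of the powers of `g` as idempotents; if they agree, then `g = 1`. This applies to the odd part of
any element (`IsGUSC.eq_one_of_pow_eq_one`). -/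

section GUSC

variable {A : Type*} [Ring A]

/-- A ring with a ring homomorphism to `ZMod 2` detecting units is GUSC. -/
theorem isGUSC_of_isUnit_of_map_eq_one (φ : A →+* ZMod 2) (h : ∀ a, φ a = 1 → IsUnit a) :
    IsGUSC A := by
  have h01 : ∀ z : ZMod 2, z ≠ 1 → z = 0 := by decide
  intro a ha
  have ha0 : φ a = 0 := h01 _ fun h1 => ha (h a h1)
  refine ⟨1, ⟨IsIdempotentElem.one, ?_, by simp⟩, ?_⟩
  · refine h _ ?_
    rw [map_sub, ha0, map_one]
    decide
  · rintro e ⟨he, hu, -⟩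
    have hφ : φ e = 1 := by
      by_contra hne
      have := hu.map φ
      rw [map_sub, ha0, h01 _ hne, sub_zero] at this
      exact not_isUnit_zero this
    exact (h e hφ).mul_left_cancel (by rw [he.eq, mul_one])

/-- `(1 - g) ∑ k g ^ k = ∑ g ^ k - n` when `g ^ n = 1`. -/
theorem one_sub_mul_sum_nsmul_pow (g : A) (n : ℕ) :
    (1 - g) * ∑ k ∈ Finset.range n, (k : A) * g ^ k
      = ∑ k ∈ Finset.range n, g ^ k - 1 - (n - 1 : A) * g ^ n := by
  induction n with
  | zero => simp
  | succ n ih =>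
    have hc : g * (n : A) = n * g := (Nat.cast_commute n g).eq.symm
    rw [Finset.sum_range_succ, mul_add, ih, Finset.sum_range_succ, pow_succ']
    have h : (1 - g) * (n * g ^ n) = n * g ^ n - n * (g * g ^ n) := by
      rw [sub_mul, one_mul, ← mul_assoc, hc, mul_assoc]
    rw [h]
    push_cast
    noncomm_ring

/-- If `g` has finite order invertible in the ring and `1 - g` is not a unit, then `1 - g` has two
different strongly clean decompositions unless `g = 1`. -/
theorem IsGUSC.eq_one_of_pow_eq_one (hA : IsGUSC A) {g : A} {n : ℕ} (hn : IsUnit (n : A))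
    (hg : g ^ n = 1) (h1 : ¬ IsUnit (1 - g)) : g = 1 := by
  obtain ⟨u, hu⟩ := hn
  set c : A := ((u⁻¹ : Aˣ) : A) with hc
  have hcn : c * n = 1 := by rw [← hu]; simp [hc]
  have hcomm : ∀ x : A, Commute c x := fun x =>
    Commute.units_inv_left (by rw [hu]; exact Nat.cast_commute n x)
  set N : A := ∑ k ∈ Finset.range n, g ^ k with hN
  set S : A := ∑ k ∈ Finset.range n, (k : A) * g ^ k with hS
  have hgS : (1 - g) * S = N - n := by
    rw [hS, one_sub_mul_sum_nsmul_pow, hg, ← hN]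
    noncomm_ring
  have hgN : (1 - g) * N = 0 := by rw [hN, mul_neg_geom_sum, hg, sub_self]
  have cgN : Commute g N := Commute.sum_right _ _ _ fun k _ => (Commute.refl g).pow_right k
  have cgS : Commute g S := Commute.sum_right _ _ _ fun k _ =>
    ((Nat.cast_commute k g).symm).mul_right ((Commute.refl g).pow_right k)
  have hgN' : g * N = N := by rwa [sub_mul, one_mul, sub_eq_zero, eq_comm] at hgN
  have hpow : ∀ k : ℕ, g ^ k * N = N := fun k => by
    induction k with
    | zero => simp
    | succ k ih => rw [pow_succ, mul_assoc, hgN', ih]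
  have hNN : N * N = n * N := by
    conv_lhs => rw [hN, Finset.sum_mul]
    rw [← hN, Finset.sum_congr rfl fun k _ => hpow k]
    simp
  set e : A := c * N with he
  have hge : g * e = e := by rw [he, ← mul_assoc, ← (hcomm g).eq, mul_assoc, hgN']
  have ceg : Commute e g := (hcomm g).mul_left cgN.symm
  have hee : e * e = e := by
    calc c * N * (c * N) = c * (c * (N * N)) := by
            rw [mul_assoc, ← mul_assoc N, ← (hcomm N).eq, mul_assoc c N N]
      _ = c * N := by rw [hNN, ← mul_assoc c (n : A), hcn, one_mul]
  have hgcS : (1 - g) * (c * S) = e - 1 := by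
    rw [← mul_assoc, ← (hcomm (1 - g)).eq, mul_assoc, hgS, mul_sub, hcn]
  have cNS : Commute N S := Commute.sum_left _ _ _ fun k _ => cgS.pow_left k
  have ceS : Commute e (c * S) :=
    ((hcomm _).mul_left ((hcomm N).symm.mul_right cNS))
  -- Peirce decomposition along `e`: `1 - g` vanishes on `e`, leaving `-1`, while on `1 - e` it has
  -- inverse `-(c * S)`.
  have hinv : (1 - g - e) * (-(c * S) * (1 - e) - e) = 1 := by
    have h2 : (1 - g) * e = 0 := by rw [sub_mul, one_mul, hge, sub_self]
    have h3 : e * (c * S) * (1 - e) = 0 := by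
      rw [ceS.eq, mul_assoc, mul_sub, mul_one, hee, sub_self, mul_zero]
    have h4 : (1 - g - e) * (-(c * S) * (1 - e) - e)
        = -(((1 - g) * (c * S)) * (1 - e)) + e * (c * S) * (1 - e) - (1 - g) * e + e * e := by
      noncomm_ring
    rw [h4, hgcS, h3, h2, hee]
    calc -((e - 1) * (1 - e)) + 0 - 0 + e = 1 - e - e + e * e + e := by noncomm_ring
      _ = 1 := by rw [hee]; abel
  have cgcS : Commute g (c * S) := (hcomm g).symm.mul_right cgS
  have hcomm' : Commute (1 - g - e) (-(c * S) * (1 - e) - e) := by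
    have k1 : Commute g (-(c * S) * (1 - e) - e) :=
      ((cgcS.neg_right).mul_right ((Commute.one_right g).sub_right ceg.symm)).sub_right ceg.symm
    have k2 : Commute e (-(c * S) * (1 - e) - e) :=
      ((ceS.neg_right).mul_right ((Commute.one_right e).sub_right (Commute.refl e))).sub_right
        (Commute.refl e)
    exact ((Commute.one_left _).sub_left k1).sub_left k2
  have hunit : IsUnit (1 - g - e) :=
    ⟨⟨_, _, hinv, by rw [← hcomm'.eq, hinv]⟩, rfl⟩
  have hgu : IsUnit g := by
    -- The case `n = 0` is allowed: `0` is then a unit and the ring is trivial.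
    rcases n.eq_zero_or_pos with rfl | hpos
    · have : Subsingleton A := subsingleton_of_zero_eq_one (by rw [← hcn]; simp)
      exact isUnit_of_subsingleton g
    · exact IsUnit.of_pow_eq_one hg hpos.ne'
  obtain ⟨f, -, huniq⟩ := hA (1 - g) h1
  have e1 : e = 1 := (huniq e ⟨hee, hunit, by
      rw [sub_mul, mul_sub, ceg.eq, one_mul, mul_one]⟩).trans
    (huniq 1 ⟨IsIdempotentElem.one, by simpa using hgu, by simp⟩).symm
  rw [e1, mul_one] at hge
  exact hge

end GUSC

/-! ### Augmentation and units of group algebras -/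

namespace MonoidAlgebra

/-- The augmentation of a group algebra. -/
noncomputable def augmentation (R G : Type*) [Semiring R] [Monoid G] : MonoidAlgebra R G →+* R :=
  liftNCRingHom (RingHom.id R) 1 fun _ _ => Commute.one_right _

@[simp]
theorem augmentation_single {R G : Type*} [Semiring R] [Monoid G] (g : G) (r : R) :
    augmentation R G (single g r) = r := by
  simp [augmentation, liftNCRingHom]

/-- An element of `k[G]` fixed by right translations is scaled by left multiplication through the
augmentation. -/
theorem mul_eq_augmentation_smul {k G : Type*} [Semiring k] [Group G] {v : MonoidAlgebra k G}
    (hv : ∀ g h, v.coeff g = v.coeff h) (x : MonoidAlgebra k G) :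
    x * v = augmentation k G x • v := by
  induction x using MonoidAlgebra.induction_linear with
  | zero => simp
  | add f g hf hg => rw [add_mul, hf, hg, map_add, add_smul]
  | single a b =>
    ext h
    rw [augmentation_single]
    simp [hv (a⁻¹ * h) h]

/-- If `x` killed some nonzero vector on its right, the `p`-group `H`, acting by right translations
on this finite annihilator, would fix a nonzero `v`. Such a `v` has constant coefficients, so `x *
v` is a nonzero multiple of it. -/
theorem isUnit_of_augmentation_ne_zero {p : ℕ} [Fact p.Prime] {H : Type*} [Group H] [Finite H]
    (hH : IsPGroup p H) {x : MonoidAlgebra (ZMod p) H} (hx : augmentation (ZMod p) H x ≠ 0) :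
    IsUnit x := by
  have : Finite (MonoidAlgebra (ZMod p) H) := by
    have : Finite (H →₀ ZMod p) := Finite.of_injective _ DFunLike.coe_injective
    exact Finite.of_equiv _ coeffEquiv.symm
  let K : AddSubgroup (MonoidAlgebra (ZMod p) H) := (AddMonoidHom.mulLeft x).ker
  have hK : ∀ v, v ∈ K ↔ x * v = 0 := fun v => AddMonoidHom.mem_ker
  suffices hbot : ∀ v, x * v = 0 → v = 0 by
    refine IsLeftRegular.isUnit_of_finite fun a b hab => ?_
    exact sub_eq_zero.1 (hbot _ (by rw [mul_sub, sub_eq_zero]; exact hab))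
  by_contra! hne
  obtain ⟨w, hw, hw0⟩ := hne
  let : MulAction H K :=
    { smul := fun h v => ⟨v.1 * single h⁻¹ 1, by
        rw [hK, ← mul_assoc, (hK _).1 v.2, zero_mul]⟩
      one_smul := fun v => Subtype.ext (by
        change v.1 * single (1 : H)⁻¹ 1 = v.1
        rw [inv_one, ← one_def, mul_one])
      mul_smul := fun g h v => Subtype.ext (by
        change v.1 * single (g * h)⁻¹ 1 = v.1 * single h⁻¹ 1 * single g⁻¹ 1
        rw [mul_assoc, single_mul_single, mul_inv_rev, mul_one]) }
  have hsmul : ∀ (h : H) (v : K), ((h • v : K) : MonoidAlgebra (ZMod p) H)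
      = v.1 * single h⁻¹ 1 := fun _ _ => rfl
  have hcard : p ∣ Nat.card K := by
    have hord : addOrderOf (⟨w, (hK w).2 hw⟩ : K) = p := by
      refine addOrderOf_eq_prime (Subtype.ext ?_) fun h => hw0 (congrArg Subtype.val h)
      change p • w = 0
      ext h
      simp [← Nat.cast_smul_eq_nsmul (ZMod p)]
    exact hord.symm.dvd.trans (addOrderOf_dvd_natCard _)
  obtain ⟨v, hv, hv0⟩ := hH.exists_fixed_point_of_prime_dvd_card_of_fixed_point K hcard
    (a := 0) (fun h => Subtype.ext (by rw [hsmul]; simp))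
  have hconst : ∀ g, v.1.coeff g = v.1.coeff 1 := fun g => by
    have h2 := congrArg (fun y : K => y.1.coeff 1) (hv g)
    simp only [hsmul] at h2
    simpa using h2
  have h3 := mul_eq_augmentation_smul (fun g h => (hconst g).trans (hconst h).symm) x
  rw [(hK _).1 v.2] at h3
  refine hv0 (Subtype.ext ?_)
  ext h
  have h4 := congrArg (fun y => y.coeff h) h3
  simp only [coeff_zero, Finsupp.coe_zero, Pi.zero_apply, coeff_smul, Finsupp.smul_apply,
    smul_eq_mul, zero_eq_mul] at h4
  simpa using (h4.resolve_left hx).symm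

section Nakayama

variable {R S H : Type*} [Ring R] [Ring S] [Group H] [Finite H] {π : R →+* S}

/-- Nakayama for the finitely generated left `R`-module `RH / RH x`: modulo `J(R)` the element `x`
already generates everything. -/
theorem exists_mul_eq_one_of_isUnit_map (hπ : Function.Surjective π)
    (hker : RingHom.ker π ≤ Ring.jacobson R) {x : MonoidAlgebra R H}
    (hx : IsUnit (mapRingHom H π x)) : ∃ y, y * x = 1 := by
  have hsurj : Function.Surjective (mapRingHom H π) := map_surjective (π : R →+ S) hπ
  obtain ⟨u, hu⟩ := hx
  let f : MonoidAlgebra R H →ₗ[R] MonoidAlgebra R H := LinearMap.mulRight R x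
  let N := LinearMap.range f
  have : Module.Finite R (MonoidAlgebra R H) := by infer_instance
  have hmem : ∀ w : MonoidAlgebra R H, mapRingHom H π w = 0 →
      w ∈ Ring.jacobson R • (⊤ : Submodule R (MonoidAlgebra R H)) := fun w hw => by
    have hsum : w = ∑ h ∈ w.coeff.support, w.coeff h • single h (1 : R) := by
      conv_lhs => rw [← sum_coeff_single w]
      simp [Finsupp.sum]
    rw [hsum]
    refine Submodule.sum_mem _ fun h _ => Submodule.smul_mem_smul (hker ?_) trivial
    have := congrArg (fun y => y.coeff h) hw
    simpa using this
  have htop : (⊤ : Submodule R (MonoidAlgebra R H ⧸ N)) = ⊥ := by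
    refine Submodule.FG.eq_bot_of_le_jacobson_smul Module.Finite.fg_top ?_
    rintro q -
    obtain ⟨m, rfl⟩ := N.mkQ_surjective q
    obtain ⟨z, hz⟩ := hsurj (mapRingHom H π m * ↑u⁻¹)
    have h1 : mapRingHom H π (m - z * x) = 0 := by
      rw [map_sub, map_mul, hz, ← hu]; simp
    have h2 : N.mkQ m = N.mkQ (m - z * x) := by
      rw [map_sub, eq_comm, sub_eq_self, Submodule.mkQ_apply, Submodule.Quotient.mk_eq_zero]
      exact ⟨z, rfl⟩
    rw [h2]
    have h3 := Submodule.mem_map_of_mem (f := N.mkQ) (hmem _ h1)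
    rw [Submodule.map_smul''] at h3
    exact Submodule.smul_mono le_rfl le_top h3
  have h1 : N.mkQ 1 ∈ (⊥ : Submodule R (MonoidAlgebra R H ⧸ N)) := htop ▸ trivial
  rw [Submodule.mem_bot, Submodule.mkQ_apply, Submodule.Quotient.mk_eq_zero] at h1
  exact h1

/-- Units of a group algebra of a finite group lift along surjections with kernel in the Jacobson
radical of the coefficient ring. -/
theorem isUnit_of_isUnit_map (hπ : Function.Surjective π)
    (hker : RingHom.ker π ≤ Ring.jacobson R) {x : MonoidAlgebra R H}
    (hx : IsUnit (mapRingHom H π x)) : IsUnit x := by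
  obtain ⟨y, hy⟩ := exists_mul_eq_one_of_isUnit_map hπ hker hx
  -- The left inverse `y` is a unit modulo the kernel too, so it has a left inverse, necessarily
  -- `x`.
  have hy' : IsUnit (mapRingHom H π y) := by
    have h := congrArg (mapRingHom H π) hy
    rw [map_mul, map_one] at h
    obtain ⟨u, hu⟩ := hx
    rw [← hu] at h
    refine ⟨u⁻¹, ?_⟩
    rw [← one_mul (u⁻¹ : (MonoidAlgebra S H)ˣ).val, ← h, mul_assoc, u.mul_inv, mul_one]
  obtain ⟨z, hz⟩ := exists_mul_eq_one_of_isUnit_map hπ hker hy'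
  have hzx : z = x := left_inv_eq_right_inv hz hy
  rw [hzx] at hz
  exact isUnit_iff_exists.2 ⟨y, hz, hy⟩

end Nakayama

theorem augmentation_mapRingHom {R S G : Type*} [Semiring R] [Semiring S] [Monoid G] (π : R →+* S)
    (x : MonoidAlgebra R G) :
    augmentation S G (mapRingHom G π x) = π (augmentation R G x) := by
  induction x using MonoidAlgebra.induction_linear with
  | zero => simp
  | add f g hf hg => simp only [map_add, hf, hg]
  | single a b => rw [mapRingHom_single]; simp

theorem augmentation_mapDomainRingHom {R G H : Type*} [Semiring R] [Monoid G] [Monoid H]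
    (f : H →* G) (x : MonoidAlgebra R H) :
    augmentation R G (mapDomainRingHom R f x) = augmentation R H x := by
  induction x using MonoidAlgebra.induction_linear with
  | zero => simp
  | add f g hf hg => simp only [map_add, hf, hg]
  | single a b => simp

/-- Over a ring `R` with a surjection to `ZMod p` with kernel in the Jacobson radical, the elements
of nonzero augmentation modulo `p` in the group algebra of a locally finite `p`-group are units. -/
theorem isUnit_of_map_augmentation_ne_zero {p : ℕ} [Fact p.Prime] {R G : Type*} [Ring R] [Group G]
    {π : R →+* ZMod p} (hπ : Function.Surjective π) (hker : RingHom.ker π ≤ Ring.jacobson R)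
    (hG : IsLocallyFiniteGroup G) (hp : IsPGroup p G) {x : MonoidAlgebra R G}
    (hx : π (augmentation R G x) ≠ 0) : IsUnit x := by
  let H : Subgroup G := Subgroup.closure x.coeff.support
  have : Finite H := hG H ⟨x.coeff.support, rfl⟩
  obtain ⟨y, hy⟩ : ∃ y, mapDomainRingHom R H.subtype y = x :=
    ⟨comapDomain H.subtype H.subtype_injective x, mapDomain_comapDomain
      (fun g hg => ⟨⟨g, Subgroup.subset_closure hg⟩, rfl⟩) _⟩
  rw [← hy, augmentation_mapDomainRingHom, ← augmentation_mapRingHom] at hx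
  rw [← hy]
  exact (isUnit_of_isUnit_map hπ hker
    (isUnit_of_augmentation_ne_zero (hp.to_subgroup H) hx)).map _

end MonoidAlgebra

/-- No maximal left ideal contains an element of `1 + J(R)`, so such an element has a left inverse,
which again lies in `1 + J(R)`. -/
theorem isUnit_of_sub_one_mem_ring_jacobson {R : Type*} [Ring R] {r : R}
    (h : r - 1 ∈ Ring.jacobson R) : IsUnit r := by
  have key : ∀ s : R, s - 1 ∈ Ring.jacobson R → ∃ y, y * s = 1 := fun s hs => by
    by_contra! hne
    have hspan : Ideal.span {s} ≠ ⊤ := fun htop => by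
      obtain ⟨y, hy⟩ := Ideal.mem_span_singleton'.1 ((Ideal.eq_top_iff_one _).1 htop)
      exact hne y hy
    obtain ⟨M, hM, hle⟩ := Ideal.exists_le_maximal _ hspan
    refine hM.ne_top ((Ideal.eq_top_iff_one _).2 ?_)
    have h1 := M.sub_mem (hle (Ideal.mem_span_singleton_self s)) (Ring.jacobson_le_of_isMaximal M hs)
    rwa [sub_sub_cancel] at h1
  obtain ⟨y, hy⟩ := key r h
  obtain ⟨z, hz⟩ := key y (by
    have h1 := (Ring.jacobson R).neg_mem ((Ring.jacobson R).mul_mem_left y h)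
    rwa [mul_sub, hy, mul_one, neg_sub] at h1)
  have hzr : z = r := left_inv_eq_right_inv hz hy
  exact ⟨⟨r, y, by rw [← hzr, hz], hy⟩, rfl⟩

theorem proposition3p2 {R : Type*} [Ring R] {G : Type*} [Group G]
    (hR : Nonempty ((R ⧸ Ring.jacobson R) ≃+* ZMod 2)) (hG : IsLocallyFiniteGroup G) :
    IsGUSC (MonoidAlgebra R G) ↔ IsPGroup 2 G := by
  obtain ⟨φ⟩ := hR
  let π : R →+* ZMod 2 := (φ : _ →+* ZMod 2).comp (Ideal.Quotient.mk (Ring.jacobson R))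
  have hπ : Function.Surjective π := φ.surjective.comp Ideal.Quotient.mk_surjective
  have hker : RingHom.ker π ≤ Ring.jacobson R := fun r hr =>
    Ideal.Quotient.eq_zero_iff_mem.1 (φ.map_eq_zero_iff.1 hr)
  constructor
  · intro hA g
    have hfin : IsOfFinOrder g := by
      have : Finite (Subgroup.zpowers g) := hG _ ⟨{g}, by simp [Subgroup.zpowers_eq_closure]⟩
      exact finite_zpowers.1 this
    obtain ⟨k, m, hm, hkm⟩ := Nat.exists_eq_two_pow_mul_odd hfin.orderOf_pos.ne'
    refine ⟨k, ?_⟩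
    have hmu : IsUnit (m : R) := by
      have : (m : ZMod 2) = 1 := ZMod.natCast_eq_one_iff_odd.2 hm
      refine isUnit_of_sub_one_mem_ring_jacobson (hker ?_)
      rw [RingHom.mem_ker, map_sub, map_natCast, map_one, this, sub_self]
    have hone := hA.eq_one_of_pow_eq_one (g := MonoidAlgebra.of R G (g ^ 2 ^ k)) (n := m)
      (by simpa using hmu.map (MonoidAlgebra.singleOneRingHom (R := R) (M := G)))
      (by rw [← map_pow, ← pow_mul, ← hkm, pow_orderOf_eq_one, map_one])
      -- `1 - g ^ 2 ^ k` has augmentation `0`, so it cannot be a unit.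
      (fun hu => by
        have := hu.map (π.comp (MonoidAlgebra.augmentation R G))
        simp at this)
    have : Nontrivial R := RingHom.domain_nontrivial π
    rw [← map_one (MonoidAlgebra.of R G)] at hone
    exact MonoidAlgebra.of_injective hone
  · intro hp
    exact isGUSC_of_isUnit_of_map_eq_one (π.comp (MonoidAlgebra.augmentation R G)) fun a ha =>
      MonoidAlgebra.isUnit_of_map_augmentation_ne_zero hπ hker hG hp (by
        rw [RingHom.comp_apply] at ha
        rw [ha]
        exact one_ne_zero)
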